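/- Let $\Theta\subset\mathbb{R}^m$ be compact, and let $F_0:\mathbb{R}^n\times\Theta\to\mathbb{R}^n$ and $F:\mathbb{R}^n\times\Theta\to\mathbb{R}^{n\times k}$, with columns $F_1,\dots,F_k$, satisfy, for some constant $L>0$, $$|F_i(x_1,\theta_1)-F_i(x_2,\theta_2)|_2\le L\big(|x_1-x_2|_2+|\theta_1-\theta_2|_2\big)\qquad (i=0,\dots,k)$$ for all $(x_1,\theta_1),(x_2,\theta_2)\in\mathbb{R}^n\times\Theta$. Let $x_0:\Theta\to\mathbb{R}^n$ be continuous, $a:[0,1]\times\mathbb{R}^n\times\Theta\to[0,\infty)$ continuous, $\beta>0$, $\nu$ a Borel probability measure on $[0,1]$, and $\mu$ a Borel probability measure on $\Theta$. For every $N\ge1$ let $\mu_N=\sum_{j=1}^N\alpha_j^N\delta_{\theta_j^N}$ with $\theta_j^N\in\Theta$, $\alpha_j^N>0$ and $\sum_{j=1}^N\alpha_j^N=1$, and assume that $\mu_N\rightharpoonup^*\mu$ as $N\to\infty$, i.e. $\int_\Theta f\,d\mu_N\to\int_\Theta f\,d\mu$ for every $f\in C^0(\Theta,\mathbb{R})$.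 Let $\mathcal{U}=L^2([0,1],\mathbb{R}^k)$. Then for every $u\in\mathcal{U}$ and $\theta\in\Theta$ there is a unique (Carathéodory) solution $x_u^\theta:[0,1]\to\mathbb{R}^n$ of $$\dot x(t)=F_0(x(t),\theta)+F(x(t),\theta)u(t),\qquad x(0)=x_0(\theta),$$ that is, a unique continuous $x$ with $x(t)=x_0(\theta)+\int_0^t\big(F_0(x(s),\theta)+F(x(s),\theta)u(s)\big)\,ds$ for all $t\in[0,1]$. Moreover, for every $u\in\mathcal{U}$ the function $(t,\theta)\mapsto a(t,x_u^\theta(t),\theta)$ is integrable with respect to $\nu\otimes P$ for every Borel probability measure $P$ on $\Theta$, so that the functionals $$\mathcal{F}(u)=\int_\Theta\int_0^1 a(t,x_u^\theta(t),\theta)\,d\nu(t)\,d\mu(\theta)+\frac{\beta}{2}\|u\|_{L^2}^2,\qquad \mathcal{F}^N(u)=\int_\Theta\int_0^1 a(t,x_u^\theta(t),\theta)\,d\nu(t)\,d\mu_N(\theta)+\frac{\beta}{2}\|u\|_{L^2}^2$$ are well defined on $\mathcal{U}$. There is $\rho>0$ such that every minimizer $\hat u$ of $\mathcal{F}$ over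 $\mathcal{U}$ satisfies $\|\hat u\|_{L^2}\le\rho$. Finally, for every $\rho>0$, the restrictions of $\mathcal{F}^N$ to $\mathcal{X}=\{u\in\mathcal{U}:\|u\|_{L^2}\le\rho\}$, equipped with the weak topology of $L^2$, $\Gamma$-converge to the restriction of $\mathcal{F}$ as $N\to\infty$. That is: (liminf condition) for every $u\in\mathcal{X}$ and every sequence $(u_N)\subset\mathcal{X}$ with $u_N\rightharpoonup u$ weakly in $L^2$, $\mathcal{F}(u)\le\liminf_{N\to\infty}\mathcal{F}^N(u_N)$; and (limsup condition) for every $u\in\mathcal{X}$ there is a sequence $(u_N)\subset\mathcal{X}$ with $u_N\rightharpoonup u$ weakly in $L^2$ and $\mathcal{F}(u)\ge\limsup_{N\to\infty}\mathcal{F}^N(u_N)$. -/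

import Mathlib

open MeasureTheory Filter Topology
open scoped unitInterval

noncomputable section

/-- The state space `ℝ^d` with the Euclidean norm. -/
abbrev Euc (d : ℕ) : Type := EuclideanSpace ℝ (Fin d)

/-- The Hilbert space of admissible controls `𝒰 = L²([0,1], ℝ^k)`. -/
abbrev Control (k : ℕ) : Type := Lp (Euc k) 2 (volume : Measure I)

/-- The `i`-th column of an `n × k` matrix, as a vector of `ℝ^n`. -/
def column {n k : ℕ} (M : Matrix (Fin n) (Fin k) ℝ) (i : Fin k) : Euc n :=
  WithLp.toLp 2 fun r => M r i

/-- The velocity `F₀^θ(y) + F^θ(y) w` at the state `y`, for the control value `w`. -/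
def velocity {n k : ℕ} {T : Type*} (F₀ : Euc n → T → Euc n)
    (F : Euc n → T → Matrix (Fin n) (Fin k) ℝ) (θ : T) (y : Euc n) (w : Euc k) : Euc n :=
  F₀ y θ + WithLp.toLp 2 ((F y θ).mulVec w)

/-- `x : [0,1] → ℝ^n` is the (Carathéodory) solution of the Cauchy problem
`ẋ(t) = F₀^θ(x(t)) + F^θ(x(t)) u(t)`, `x(0) = x₀(θ)`, that is, `x` is continuous and
`x(t) = x₀(θ) + ∫_0^t (F₀^θ(x(s)) + F^θ(x(s)) u(s)) ds` for every `t ∈ [0,1]`. -/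
def IsTrajectory {n k : ℕ} {T : Type*} (F₀ : Euc n → T → Euc n)
    (F : Euc n → T → Matrix (Fin n) (Fin k) ℝ) (x₀ : T → Euc n)
    (u : Control k) (θ : T) (x : C(I, Euc n)) : Prop :=
  ∀ t : I, x t = x₀ θ + ∫ s in Set.Iic t, velocity F₀ F θ (x s) (u s)

/-- The trajectory `x_u^θ`: the solution of the Cauchy problem with parameter `θ` and
control `u`. -/
def trajectory {n k : ℕ} {T : Type*} (F₀ : Euc n → T → Euc n)
    (F : Euc n → T → Matrix (Fin n) (Fin k) ℝ) (x₀ : T → Euc n)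
    (u : Control k) (θ : T) : C(I, Euc n) :=
  Classical.epsilon (IsTrajectory F₀ F x₀ u θ)

/-- The ensemble functional
`u ↦ ∫_Θ ∫_0^1 a(t, x_u^θ(t), θ) dν(t) dμ(θ) + (β/2) ‖u‖²_{L²}` associated with the measure
`μ` on the parameters. -/
def ensembleCost {n k : ℕ} {T : Type*} [MeasurableSpace T] (F₀ : Euc n → T → Euc n)
    (F : Euc n → T → Matrix (Fin n) (Fin k) ℝ) (x₀ : T → Euc n)
    (a : I × Euc n × T → ℝ) (ν : Measure I) (β : ℝ) (μ : Measure T) (u : Control k) : ℝ :=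
  (∫ θ, ∫ t, a (t, trajectory F₀ F x₀ u θ t, θ) ∂ν ∂μ) + β / 2 * ‖u‖ ^ 2

/-- The closed ball of radius `ρ` centred at the origin of `L²([0,1], ℝ^k)`; as a subset of
`WeakSpace` its subtype carries the topology induced by the weak topology of `L²`. -/
def weakBall (k : ℕ) (ρ : ℝ) : Set (WeakSpace ℝ (Control k)) :=
  {v | ‖(toWeakSpace ℝ (Control k)).symm v‖ ≤ ρ}

/-- The restriction of a functional on `L²` to the ball `weakBall k ρ`, with extended real
values. -/
def restrictToBall {k : ℕ} (G : Control k → ℝ) (ρ : ℝ) (v : weakBall k ρ) : EReal :=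
  ((G ((toWeakSpace ℝ (Control k)).symm v) : ℝ) : EReal)

/-- `Γ`-convergence of a sequence of functionals (liminf and limsup condition along sequences,
the definition used on metric and on metrizable spaces). -/
def GammaConverges {X : Type*} [TopologicalSpace X] (G : ℕ → X → EReal) (G' : X → EReal) :
    Prop :=
  (∀ (u : X) (v : ℕ → X), Tendsto v atTop (𝓝 u) →
      G' u ≤ liminf (fun N => G N (v N)) atTop) ∧
  (∀ u : X, ∃ v : ℕ → X, Tendsto v atTop (𝓝 u) ∧
      limsup (fun N => G N (v N)) atTop ≤ G' u)

/-- `P = ∑_{j=1}^N α_j δ_{θ_j}` for some points `θ_j` and weights `α_j > 0` of sum `1`. -/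
def IsDiscreteWith {T : Type*} [MeasurableSpace T] (N : ℕ) (P : Measure T) : Prop :=
  ∃ (θ : Fin N → T) (α : Fin N → ℝ), (∀ j, 0 < α j) ∧ ∑ j, α j = 1 ∧
    P = ∑ j, ENNReal.ofReal (α j) • Measure.dirac (θ j)

end

theorem Continuous.integrable_of_compactSpace {X E : Type*} [TopologicalSpace X] [CompactSpace X]
    [MeasurableSpace X] [OpensMeasurableSpace X] [NormedAddCommGroup E]
    [SecondCountableTopologyEither X E] {f : X → E} (hf : Continuous f) (μ : Measure X)
    [IsFiniteMeasure μ] :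
    Integrable f μ := by
  obtain ⟨C, hC⟩ := isCompact_univ.exists_bound_of_continuousOn hf.continuousOn
  exact Integrable.of_bound hf.aestronglyMeasurable C (Eventually.of_forall fun s => hC s trivial)

section Volterra

variable {E : Type*} [NormedAddCommGroup E] [NormedSpace ℝ E]

theorem unitInterval.continuous_setIntegral_Iic {f : I → E} (hf : Integrable f) :
    Continuous fun t : I => ∫ s in Set.Iic t, f s := by
  simp_rw [← integral_indicator measurableSet_Iic]
  refine continuous_iff_continuousAt.2 fun t₀ => ?_
  refine continuousAt_of_dominated (bound := fun s => ‖f s‖)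
    (Eventually.of_forall fun t => (hf.indicator measurableSet_Iic).aestronglyMeasurable)
    (Eventually.of_forall fun t => Eventually.of_forall fun s => norm_indicator_le_norm_self _ _)
    hf.norm ?_
  filter_upwards [compl_mem_ae_iff.2 (measure_singleton t₀)] with s hs
  rcases lt_or_gt_of_ne (show s ≠ t₀ from hs) with h | h
  · refine (continuousAt_const (y := f s)).congr ?_
    filter_upwards [lt_mem_nhds h] with t ht
    exact (Set.indicator_of_mem (show s ∈ Set.Iic t from ht.le) f).symm
  · refine (continuousAt_const (y := (0 : E))).congr ?_
    filter_upwards [gt_mem_nhds h] with t ht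
    exact (Set.indicator_of_notMem (show s ∉ Set.Iic t from not_le.2 ht) f).symm

theorem unitInterval.setIntegral_Iic_exp_le {K : ℝ} (hK : 0 < K) (t : I) :
    ∫ s in Set.Iic t, Real.exp (K * ((s : ℝ) - t)) ≤ 1 / K := by
  have h := unitInterval.measurePreserving_coe.setIntegral_preimage_emb
    unitInterval.measurableEmbedding_coe (fun y : ℝ => Real.exp (K * (y - t))) (Set.Iic (t : ℝ))
  have hpre : ((↑) : I → ℝ) ⁻¹' Set.Iic (t : ℝ) = Set.Iic t := rfl
  rw [hpre] at h
  rw [h, Measure.restrict_restrict measurableSet_Iic]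
  have hfun : (fun y : ℝ => Real.exp (K * (y - t)))
      = fun y => Real.exp (-(K * t)) * Real.exp (K * y) := by
    funext y; rw [← Real.exp_add]; ring_nf
  have hint : IntegrableOn (fun y : ℝ => Real.exp (K * (y - t))) (Set.Iic (t : ℝ)) := by
    rw [hfun]; exact (integrableOn_exp_mul_Iic hK _).const_mul _
  refine (setIntegral_mono_set hint (Eventually.of_forall fun y => (Real.exp_pos _).le)
    (Eventually.of_forall fun y hy => hy.1)).trans (le_of_eq ?_)
  rw [hfun, integral_const_mul, integral_exp_mul_Iic hK, mul_div_assoc', ← Real.exp_add]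
  simp

variable {l : I → ℝ} {M : ℝ}

theorem MeasureTheory.MemLp.integrable_mul_continuous (hl : MemLp l 2) {φ : I → ℝ}
    (hφ : Continuous φ) : Integrable fun s => l s * φ s := by
  obtain ⟨C, hC⟩ := isCompact_univ.exists_bound_of_continuousOn hφ.continuousOn
  exact (hl.integrable one_le_two).mul_bdd hφ.aestronglyMeasurable
    (Eventually.of_forall fun s => hC s trivial)

/-- The weighted estimate which makes Volterra operators with an `L²` kernel contractive. -/
theorem setIntegral_Iic_mul_exp_le (hl : MemLp l 2) (hM : 0 < M) (hlM : ∫ s, l s ^ 2 ≤ M) (t : I) :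
    ∫ s in Set.Iic t, l s * Real.exp (2 * M * s) ≤ 1 / 2 * Real.exp (2 * M * t) := by
  have hsq : Integrable fun s => l s ^ 2 := hl.integrable_sq
  have hexp : Integrable fun s : I => Real.exp (4 * M * ((s : ℝ) - t)) :=
    Continuous.integrable_of_compactSpace (by fun_prop) _
  have key : ∀ s : I, l s * Real.exp (2 * M * s) ≤ Real.exp (2 * M * t) *
      (1 / (4 * M) * l s ^ 2 + M * Real.exp (4 * M * ((s : ℝ) - t))) := by
    intro s
    have h1 : Real.exp (2 * M * s) = Real.exp (2 * M * t) * Real.exp (2 * M * (s - t)) := by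
      rw [← Real.exp_add]; ring_nf
    have h2 : Real.exp (4 * M * ((s : ℝ) - t)) = Real.exp (2 * M * (s - t)) ^ 2 := by
      rw [← Real.exp_nat_mul]; ring_nf
    rw [h1, h2]
    set e := Real.exp (2 * M * ((s : ℝ) - t))
    have h3 : l s * e ≤ 1 / (4 * M) * l s ^ 2 + M * e ^ 2 := by
      have : 1 / (4 * M) * l s ^ 2 + M * e ^ 2 - l s * e = (l s - 2 * M * e) ^ 2 / (4 * M) := by
        field_simp; ring
      have : 0 ≤ (l s - 2 * M * e) ^ 2 / (4 * M) := by positivity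
      linarith
    calc _ = Real.exp (2 * M * t) * (l s * e) := by ring
      _ ≤ _ := by gcongr
  have hbd : Integrable fun s : I => 1 / (4 * M) * l s ^ 2 + M * Real.exp (4 * M * ((s : ℝ) - t)) :=
    (hsq.const_mul _).add (hexp.const_mul _)
  refine (setIntegral_mono (hl.integrable_mul_continuous (by fun_prop)).integrableOn
    (hbd.const_mul _).integrableOn key).trans ?_
  rw [integral_const_mul, integral_add (hsq.const_mul _).integrableOn
    (hexp.const_mul _).integrableOn, integral_const_mul, integral_const_mul, mul_comm]
  have h4 : ∫ s in Set.Iic t, l s ^ 2 ≤ M :=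
    (setIntegral_le_integral hsq (Eventually.of_forall fun s => sq_nonneg _)).trans hlM
  have h5 := unitInterval.setIntegral_Iic_exp_le (K := 4 * M) (by positivity) t
  gcongr
  calc _ ≤ 1 / (4 * M) * M + M * (1 / (4 * M)) := by gcongr
    _ = 1 / 2 := by field_simp; norm_num

/-- Grönwall's inequality with an `L²` kernel. -/
theorem gronwall_of_memLp_two (hl : MemLp l 2) (hl0 : ∀ s, 0 ≤ l s) (hM : 0 < M)
    (hlM : ∫ s, l s ^ 2 ≤ M) {φ : I → ℝ} (hφ : Continuous φ) (hφ0 : ∀ t, 0 ≤ φ t) {c : ℝ}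
    (hc : 0 ≤ c) (h : ∀ t, φ t ≤ c + ∫ s in Set.Iic t, l s * φ s) (t : I) :
    φ t ≤ 2 * Real.exp (2 * M) * c := by
  obtain ⟨t₀, -, ht₀⟩ := isCompact_univ.exists_isMaxOn Set.univ_nonempty
    (f := fun t : I => Real.exp (-(2 * M * t)) * φ t) (by fun_prop)
  set W := Real.exp (-(2 * M * t₀)) * φ t₀ with hW
  have hW0 : 0 ≤ W := mul_nonneg (Real.exp_pos _).le (hφ0 _)
  have hle : ∀ s : I, φ s ≤ W * Real.exp (2 * M * s) := by
    intro s
    have h1 : Real.exp (-(2 * M * s)) * φ s ≤ W := ht₀ (Set.mem_univ s)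
    calc φ s = (Real.exp (-(2 * M * s)) * φ s) * Real.exp (2 * M * s) := by
          rw [mul_right_comm, ← Real.exp_add]; simp
      _ ≤ _ := by gcongr
  have hint : ∫ s in Set.Iic t₀, l s * φ s ≤ W * (1 / 2 * Real.exp (2 * M * t₀)) := by
    refine le_trans ?_ (mul_le_mul_of_nonneg_left (setIntegral_Iic_mul_exp_le hl hM hlM t₀) hW0)
    rw [← integral_const_mul]
    refine setIntegral_mono (hl.integrable_mul_continuous hφ).integrableOn
      ((hl.integrable_mul_continuous (by fun_prop)).const_mul _).integrableOn fun s => ?_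
    calc l s * φ s ≤ l s * (W * Real.exp (2 * M * s)) :=
          mul_le_mul_of_nonneg_left (hle s) (hl0 s)
      _ = _ := by ring
  have hWc : W ≤ 2 * c := by
    have h1 : W ≤ Real.exp (-(2 * M * t₀)) * (c + W * (1 / 2 * Real.exp (2 * M * t₀))) := by
      rw [hW]; gcongr; exact (h t₀).trans (by gcongr)
    have h2 : Real.exp (-(2 * M * t₀)) * (c + W * (1 / 2 * Real.exp (2 * M * t₀)))
        = Real.exp (-(2 * M * t₀)) * c + W / 2 := by
      rw [Real.exp_neg]; field_simp
    have h3 : Real.exp (-(2 * M * t₀)) * c ≤ c :=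
      mul_le_of_le_one_left hc (Real.exp_le_one_iff.2
        (neg_nonpos.2 (mul_nonneg (by positivity) t₀.2.1)))
    linarith
  calc φ t ≤ W * Real.exp (2 * M * t) := hle t
    _ ≤ (2 * c) * Real.exp (2 * M) := by
      have := mul_le_of_le_one_right (by positivity : 0 ≤ 2 * M) t.2.2
      gcongr
    _ = _ := by ring

theorem norm_setIntegral_Iic_sub_le {g : I → E → E} {x y : I → E} (t : I)
    (hlip : ∀ s y₁ y₂, ‖g s y₁ - g s y₂‖ ≤ l s * ‖y₁ - y₂‖) (hl : MemLp l 2)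
    (hx : Continuous x) (hy : Continuous y)
    (hgx : Integrable fun s => g s (x s)) (hgy : Integrable fun s => g s (y s)) :
    ‖(∫ s in Set.Iic t, g s (x s)) - ∫ s in Set.Iic t, g s (y s)‖
      ≤ ∫ s in Set.Iic t, l s * ‖x s - y s‖ := by
  rw [← integral_sub hgx.integrableOn hgy.integrableOn]
  exact norm_integral_le_of_norm_le (hl.integrable_mul_continuous (by fun_prop)).integrableOn
    (Eventually.of_forall fun s => hlip _ _ _)

theorem existsUnique_volterra [CompleteSpace E] {g : I → E → E} (ξ : E) (hl : MemLp l 2)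
    (hl0 : ∀ s, 0 ≤ l s) (hlip : ∀ s y₁ y₂, ‖g s y₁ - g s y₂‖ ≤ l s * ‖y₁ - y₂‖)
    (hg : ∀ x : C(I, E), Integrable fun s => g s (x s)) :
    ∃! x : C(I, E), ∀ t : I, x t = ξ + ∫ s in Set.Iic t, g s (x s) := by
  obtain ⟨M, hM, hlM⟩ : ∃ M : ℝ, 0 < M ∧ ∫ s, l s ^ 2 ≤ M :=
    ⟨max 1 (∫ s, l s ^ 2), by positivity, le_max_right _ _⟩
  refine existsUnique_of_exists_of_unique ?_ fun x y hx hy => ?_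
  · let e : ℝ → C(I, ℝ) := fun K => ⟨fun t => Real.exp (K * t), by fun_prop⟩
    have he : ∀ y : C(I, E), ∀ s : I, (e (2 * M) • y) s = Real.exp (2 * M * s) • y s :=
      fun y s => rfl
    let S : C(I, E) → C(I, E) := fun y =>
      ⟨fun t => Real.exp (-(2 * M * t)) •
        (ξ + ∫ s in Set.Iic t, g s ((e (2 * M) • y) s)),
        Continuous.smul (by fun_prop) (continuous_const.add
          (unitInterval.continuous_setIntegral_Iic (hg (e (2 * M) • y))))⟩
    have hS : ContractingWith (1 / 2) S := by
      refine ⟨by rw [← NNReal.coe_lt_coe]; norm_num, LipschitzWith.of_dist_le_mul fun y z => ?_⟩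
      refine (ContinuousMap.dist_le (by positivity)).2 fun t => ?_
      rw [dist_eq_norm]
      have h1 : S y t - S z t = Real.exp (-(2 * M * t)) •
          ((∫ s in Set.Iic t, g s ((e (2 * M) • y) s))
            - ∫ s in Set.Iic t, g s ((e (2 * M) • z) s)) := by
        simp only [S, ContinuousMap.coe_mk]
        rw [← smul_sub, add_sub_add_left_eq_sub]
      have h2 : ∫ s in Set.Iic t, l s * ‖(e (2 * M) • y) s - (e (2 * M) • z) s‖
          ≤ dist y z * (1 / 2 * Real.exp (2 * M * t)) := by
        refine le_trans ?_
          (mul_le_mul_of_nonneg_left (setIntegral_Iic_mul_exp_le hl hM hlM t) dist_nonneg)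
        rw [← integral_const_mul]
        refine setIntegral_mono (hl.integrable_mul_continuous
            ((e (2 * M) • y).continuous.sub (e (2 * M) • z).continuous).norm).integrableOn
          ((hl.integrable_mul_continuous (by fun_prop)).const_mul _).integrableOn fun s => ?_
        have h3 : ‖y s - z s‖ ≤ dist y z := by
          rw [← dist_eq_norm]; exact ContinuousMap.dist_apply_le_dist s
        simp only [he]
        rw [← smul_sub, norm_smul, Real.norm_of_nonneg (Real.exp_pos _).le]
        calc _ = ‖y s - z s‖ * (l s * Real.exp (2 * M * s)) := by ring
          _ ≤ _ := by
            have := hl0 s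
            gcongr
      rw [h1, norm_smul, Real.norm_of_nonneg (Real.exp_pos _).le]
      calc _ ≤ Real.exp (-(2 * M * t)) * (dist y z * (1 / 2 * Real.exp (2 * M * t))) := by
            gcongr
            exact (norm_setIntegral_Iic_sub_le t hlip hl (e (2 * M) • y).continuous
              (e (2 * M) • z).continuous (hg _) (hg _)).trans h2
        _ = 1 / 2 * dist y z := by rw [Real.exp_neg]; field_simp
        _ = _ := by simp
    obtain ⟨y, hy⟩ : ∃ y, S y = y := ⟨_, hS.fixedPoint_isFixedPt⟩
    refine ⟨e (2 * M) • y, fun t => ?_⟩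
    have hfix : Real.exp (-(2 * M * t)) • (ξ + ∫ s in Set.Iic t, g s ((e (2 * M) • y) s)) = y t :=
      DFunLike.congr_fun hy t
    rw [he, ← hfix, smul_smul, ← Real.exp_add, add_neg_cancel, Real.exp_zero, one_smul]
  · ext t
    have := gronwall_of_memLp_two hl hl0 hM hlM (φ := fun t => ‖x t - y t‖) (by fun_prop)
      (fun t => norm_nonneg _) le_rfl (fun t => by
        rw [zero_add, hx t, hy t, add_sub_add_left_eq_sub]
        exact norm_setIntegral_Iic_sub_le t hlip hl x.continuous y.continuous (hg x) (hg y)) t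
    rw [mul_zero] at this
    exact sub_eq_zero.1 (norm_le_zero_iff.1 this)

end Volterra

section ControlAffine

variable {E U T : Type*} [NormedAddCommGroup E] [NormedSpace ℝ E]
  [NormedAddCommGroup U] [NormedSpace ℝ U]

omit [NormedSpace ℝ U] in
theorem MeasureTheory.Lp.integral_norm_sq_eq {α : Type*} [MeasurableSpace α] {μ : Measure α}
    (u : Lp U 2 μ) : ∫ s, ‖u s‖ ^ 2 ∂μ = ‖u‖ ^ 2 := by
  have h := (Lp.memLp u).eLpNorm_eq_integral_rpow_norm two_ne_zero ENNReal.ofNat_ne_top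
  have h0 : 0 ≤ ∫ s, ‖u s‖ ^ 2 ∂μ := integral_nonneg fun s => sq_nonneg _
  rw [Lp.norm_def, h, ENNReal.toReal_ofReal (by positivity)]
  simp only [ENNReal.toReal_ofNat, Real.rpow_ofNat]
  rw [← Real.rpow_natCast, ← Real.rpow_mul h0]
  simp

omit [NormedSpace ℝ U] in
theorem MeasureTheory.Lp.integral_norm_le {α : Type*} [MeasurableSpace α] {μ : Measure α}
    [IsProbabilityMeasure μ] (u : Lp U 2 μ) : ∫ s, ‖u s‖ ∂μ ≤ ‖u‖ := by
  rw [integral_norm_eq_lintegral_enorm (Lp.aestronglyMeasurable u),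
    ← eLpNorm_one_eq_lintegral_enorm, Lp.norm_def]
  exact ENNReal.toReal_mono (Lp.eLpNorm_ne_top u)
    (eLpNorm_le_eLpNorm_of_exponent_le one_le_two (Lp.aestronglyMeasurable u))

theorem integrable_clm_apply {B : I → U →L[ℝ] E} (hB : Continuous B)
    (u : Lp U 2 (volume : Measure I)) :
    Integrable fun s => B s (u s) := by
  obtain ⟨C, hC⟩ := isCompact_univ.exists_bound_of_continuousOn hB.continuousOn
  refine (((Lp.memLp u).integrable one_le_two).norm.const_mul C).mono'
    ((ContinuousLinearMap.id ℝ (U →L[ℝ] E)).aestronglyMeasurable_comp₂ hB.aestronglyMeasurable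
      (Lp.aestronglyMeasurable u))
    (Eventually.of_forall fun s => (B s).le_of_opNorm_le (hC s trivial) _)

/-- The operator `v ↦ ∫_0^t B(s) v(s) ds` on `L²([0,1], U)`. -/
noncomputable def primitiveCLM {B : I → U →L[ℝ] E} (hB : Continuous B) (t : I) :
    Lp U 2 (volume : Measure I) →L[ℝ] E :=
  LinearMap.mkContinuousOfExistsBound
    { toFun := fun v => ∫ s in Set.Iic t, B s (v s)
      map_add' := fun v w => by
        rw [← integral_add (integrable_clm_apply hB v).integrableOn
          (integrable_clm_apply hB w).integrableOn]
        refine integral_congr_ae (ae_restrict_of_ae ?_)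
        filter_upwards [Lp.coeFn_add v w] with s hs
        rw [hs, Pi.add_apply, map_add]
      map_smul' := fun c v => by
        rw [RingHom.id_apply, ← integral_smul]
        refine integral_congr_ae (ae_restrict_of_ae ?_)
        filter_upwards [Lp.coeFn_smul c v] with s hs
        rw [hs, Pi.smul_apply, map_smul] }
    (by
      obtain ⟨C, hC⟩ := isCompact_univ.exists_bound_of_continuousOn hB.continuousOn
      refine ⟨C, fun v => ?_⟩
      have hv : Integrable fun s => ‖v s‖ := ((Lp.memLp v).integrable one_le_two).norm
      have hC0 : 0 ≤ C := (norm_nonneg _).trans (hC 0 trivial)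
      refine (norm_integral_le_of_norm_le (hv.const_mul C).integrableOn (Eventually.of_forall
        fun s => (B s).le_of_opNorm_le (hC s trivial) _)).trans ?_
      rw [integral_const_mul]
      gcongr
      exact (setIntegral_le_integral hv (Eventually.of_forall fun s => norm_nonneg _)).trans
        (Lp.integral_norm_le v))

variable [TopologicalSpace T]

theorem tendsto_integral_sq_norm_indicator_sub [FirstCountableTopology T] [CompactSpace T]
    (B : C(I × T, U →L[ℝ] E)) (p : I × T) :
    Tendsto (fun q : I × T => ∫ s, ‖(Set.Iic q.1).indicator (fun s => B (s, q.2)) s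
      - (Set.Iic p.1).indicator (fun s => B (s, p.2)) s‖ ^ 2) (𝓝 p) (𝓝 0) := by
  obtain ⟨C, hC⟩ := isCompact_univ.exists_bound_of_continuousOn B.continuous.continuousOn
  have hmeas : ∀ q : I × T, AEStronglyMeasurable
      ((Set.Iic q.1).indicator (fun s => B (s, q.2))) (volume : Measure I) := fun q =>
    (Continuous.aestronglyMeasurable (by fun_prop)).indicator measurableSet_Iic
  have hbd : ∀ (q : I × T) (s : I), ‖(Set.Iic q.1).indicator (fun s => B (s, q.2)) s‖ ≤ C :=
    fun q s => (norm_indicator_le_norm_self _ _).trans (hC _ trivial)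
  rw [← integral_zero I ℝ]
  refine tendsto_integral_filter_of_dominated_convergence (fun _ => (C + C) ^ 2)
    (Eventually.of_forall fun q => (((hmeas q).sub (hmeas p)).norm.pow 2))
    (Eventually.of_forall fun q => Eventually.of_forall fun s => ?_) (integrable_const _) ?_
  · rw [Real.norm_of_nonneg (by positivity)]
    gcongr
    exact (norm_sub_le _ _).trans (add_le_add (hbd q s) (hbd p s))
  · filter_upwards [compl_mem_ae_iff.2 (measure_singleton p.1)] with s hs
    rcases lt_or_gt_of_ne (show s ≠ p.1 from hs) with h | h
    · have hlim : Tendsto (fun q : I × T => ‖B (s, q.2) - B (s, p.2)‖ ^ 2) (𝓝 p) (𝓝 0) := by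
        have : Continuous fun q : I × T => ‖B (s, q.2) - B (s, p.2)‖ ^ 2 := by fun_prop
        simpa using this.tendsto p
      refine hlim.congr' ?_
      filter_upwards [continuous_fst.continuousAt.eventually (lt_mem_nhds h)] with q hq
      rw [Set.indicator_of_mem (show s ∈ Set.Iic q.1 from le_of_lt hq),
        Set.indicator_of_mem (show s ∈ Set.Iic p.1 from h.le)]
    · refine tendsto_const_nhds.congr' ?_
      filter_upwards [continuous_fst.continuousAt.eventually (gt_mem_nhds h)] with q hq
      rw [Set.indicator_of_notMem (show s ∉ Set.Iic q.1 from not_le.2 hq),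
        Set.indicator_of_notMem (show s ∉ Set.Iic p.1 from not_le.2 h)]
      simp

/-- The primitives of `B(·, θ) v`, for `v` in a ball of `L²`, are equicontinuous. -/
theorem equicontinuous_primitive [FirstCountableTopology T] [CompactSpace T]
    (B : C(I × T, U →L[ℝ] E)) {ι : Type*} {v : ι → Lp U 2 (volume : Measure I)} {R : ℝ}
    (hv : ∀ i, ‖v i‖ ≤ R) :
    Equicontinuous fun i (q : I × T) => ∫ s in Set.Iic q.1, B (s, q.2) (v i s) := by
  intro p
  rw [Metric.equicontinuousAt_iff_right]
  intro ε hε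
  obtain ⟨δ, hδ, hδε⟩ : ∃ δ : ℝ, 0 < δ ∧ δ * R ^ 2 < ε / 2 := by
    refine ⟨ε / (2 * (R ^ 2 + 1)), by positivity, ?_⟩
    rw [div_mul_eq_mul_div, div_lt_div_iff₀ (by positivity) two_pos]
    nlinarith
  filter_upwards [(tendsto_integral_sq_norm_indicator_sub B p).eventually
    (gt_mem_nhds (show 0 < 4 * δ * (ε / 2) by positivity))] with q hq i
  set D : I → U →L[ℝ] E := fun s => (Set.Iic q.1).indicator (fun s => B (s, q.2)) s
      - (Set.Iic p.1).indicator (fun s => B (s, p.2)) s with hD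
  have hind : ∀ r : I × T, Integrable fun s =>
      (Set.Iic r.1).indicator (fun s => B (s, r.2)) s (v i s) := by
    intro r
    refine ((integrable_clm_apply (B := fun s => B (s, r.2)) (by fun_prop) (v i)).indicator
      (measurableSet_Iic (a := r.1))).congr (Eventually.of_forall fun s => ?_)
    by_cases hs : s ∈ Set.Iic r.1 <;> simp [hs]
  have heq : ∀ r : I × T, ∫ s in Set.Iic r.1, B (s, r.2) (v i s)
      = ∫ s, (Set.Iic r.1).indicator (fun s => B (s, r.2)) s (v i s) := by
    intro r
    rw [← integral_indicator measurableSet_Iic]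
    refine integral_congr_ae (Eventually.of_forall fun s => ?_)
    by_cases hs : s ∈ Set.Iic r.1 <;> simp [hs]
  have hmeas : ∀ r : I × T, AEStronglyMeasurable
      ((Set.Iic r.1).indicator (fun s => B (s, r.2))) (volume : Measure I) := fun r =>
    (Continuous.aestronglyMeasurable (by fun_prop)).indicator measurableSet_Iic
  have hDsq : Integrable fun s => ‖D s‖ ^ 2 := by
    obtain ⟨C, hC⟩ := isCompact_univ.exists_bound_of_continuousOn B.continuous.continuousOn
    refine Integrable.of_bound (((hmeas q).sub (hmeas p)).norm.pow 2) ((C + C) ^ 2)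
      (Eventually.of_forall fun s => ?_)
    rw [Real.norm_of_nonneg (by positivity)]
    gcongr
    exact (norm_sub_le _ _).trans (add_le_add
      ((norm_indicator_le_norm_self _ _).trans (hC _ trivial))
      ((norm_indicator_le_norm_self _ _).trans (hC _ trivial)))
  have hvsq : Integrable fun s => ‖v i s‖ ^ 2 := (Lp.memLp (v i)).norm.integrable_sq
  rw [dist_comm, dist_eq_norm, heq, heq, ← integral_sub (hind q) (hind p)]
  calc _ ≤ ∫ s, (1 / (4 * δ) * ‖D s‖ ^ 2 + δ * ‖v i s‖ ^ 2) := by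
        refine norm_integral_le_of_norm_le ((hDsq.const_mul _).add (hvsq.const_mul _))
          (Eventually.of_forall fun s => ?_)
        rw [← sub_apply]
        refine ((D s).le_opNorm (v i s)).trans ?_
        have h1 : 1 / (4 * δ) * ‖D s‖ ^ 2 + δ * ‖v i s‖ ^ 2 - ‖D s‖ * ‖v i s‖
            = (‖D s‖ - 2 * δ * ‖v i s‖) ^ 2 / (4 * δ) := by field_simp; ring
        have h2 : 0 ≤ (‖D s‖ - 2 * δ * ‖v i s‖) ^ 2 / (4 * δ) := by positivity
        linarith
    _ = 1 / (4 * δ) * (∫ s, ‖D s‖ ^ 2) + δ * ‖v i‖ ^ 2 := by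
        rw [integral_add (hDsq.const_mul _) (hvsq.const_mul _), integral_const_mul,
          integral_const_mul, Lp.integral_norm_sq_eq]
    _ ≤ 1 / (4 * δ) * (4 * δ * (ε / 2)) + δ * R ^ 2 := by
        have := hv i
        gcongr
    _ < ε := by
        have : 1 / (4 * δ) * (4 * δ * (ε / 2)) = ε / 2 := by field_simp
        linarith

theorem tendsto_of_tendsto_dual {V ι : Type*} [NormedAddCommGroup V] [NormedSpace ℝ V]
    [FiniteDimensional ℝ E] {l : Filter ι} {v : ι → V} {v₀ : V}
    (hv : ∀ φ : V →L[ℝ] ℝ, Tendsto (fun i => φ (v i)) l (𝓝 (φ v₀))) (A : V →L[ℝ] E) :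
    Tendsto (fun i => A (v i)) l (𝓝 (A v₀)) := by
  let e := (Module.finBasis ℝ E).equivFunL
  rw [e.toHomeomorph.isInducing.tendsto_nhds_iff, tendsto_pi_nhds]
  exact fun i => hv ((ContinuousLinearMap.proj i).comp (e.toContinuousLinearMap.comp A))

/-- Primitives of `B(·, θ) v` depend continuously, uniformly in time and parameter, on `v` with
respect to bounded weak convergence. -/
theorem tendstoUniformly_primitive [FirstCountableTopology T] [CompactSpace T]
    [FiniteDimensional ℝ E] (B : C(I × T, U →L[ℝ] E)) {ι : Type*} {l : Filter ι}
    {v : ι → Lp U 2 (volume : Measure I)} {v₀ : Lp U 2 (volume : Measure I)} {R : ℝ}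
    (hR : ∀ i, ‖v i‖ ≤ R)
    (hv : ∀ φ : Lp U 2 (volume : Measure I) →L[ℝ] ℝ, Tendsto (fun i => φ (v i)) l (𝓝 (φ v₀))) :
    TendstoUniformly (fun i (q : I × T) => ∫ s in Set.Iic q.1, B (s, q.2) (v i s))
      (fun q => ∫ s in Set.Iic q.1, B (s, q.2) (v₀ s)) l := by
  refine UniformFun.tendsto_iff_tendstoUniformly.1
    (((equicontinuous_primitive B hR).tendsto_uniformFun_iff_pi l
      fun q => ∫ s in Set.Iic q.1, B (s, q.2) (v₀ s)).2 ?_)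
  rw [tendsto_pi_nhds]
  exact fun q => tendsto_of_tendsto_dual hv
    (primitiveCLM (B := fun s => B (s, q.2)) (by fun_prop) q.1)

end ControlAffine

section Flow

variable {E U T : Type*} [NormedAddCommGroup E] [NormedSpace ℝ E]
  [NormedAddCommGroup U] [NormedSpace ℝ U] [PseudoMetricSpace T]

/-- The drift `f₀` and the control field `f` are `L`-Lipschitz in state and parameter. -/
structure LipschitzFields (L : ℝ) (f₀ : E → T → E) (f : E → T → U →L[ℝ] E) : Prop where
  nonneg : 0 ≤ L
  drift : ∀ y₁ y₂ θ₁ θ₂, ‖f₀ y₁ θ₁ - f₀ y₂ θ₂‖ ≤ L * (‖y₁ - y₂‖ + dist θ₁ θ₂)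
  field : ∀ y₁ y₂ θ₁ θ₂, ‖f y₁ θ₁ - f y₂ θ₂‖ ≤ L * (‖y₁ - y₂‖ + dist θ₁ θ₂)

omit [NormedSpace ℝ E] in
theorem continuous_of_norm_sub_le {G : Type*} [SeminormedAddCommGroup G] {L : ℝ}
    {h : E → T → G} (hh : ∀ y₁ y₂ θ₁ θ₂, ‖h y₁ θ₁ - h y₂ θ₂‖ ≤ L * (‖y₁ - y₂‖ + dist θ₁ θ₂)) :
    Continuous fun p : E × T => h p.1 p.2 := by
  refine continuous_iff_continuousAt.2 fun p => ?_
  rw [ContinuousAt, tendsto_iff_norm_sub_tendsto_zero]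
  have hc : Continuous fun q : E × T => L * (‖q.1 - p.1‖ + dist q.2 p.2) := by fun_prop
  refine squeeze_zero (fun _ => norm_nonneg _) (fun q => hh q.1 p.1 q.2 p.2) ?_
  simpa using hc.tendsto p

namespace LipschitzFields

variable {L : ℝ} {f₀ : E → T → E} {f : E → T → U →L[ℝ] E}

section
variable (h : LipschitzFields L f₀ f)
include h

theorem continuous_drift {X : Type*} [TopologicalSpace X] {x : X → E} {θ : X → T}
    (hx : Continuous x) (hθ : Continuous θ) : Continuous fun p => f₀ (x p) (θ p) :=
  (continuous_of_norm_sub_le h.drift).comp (hx.prodMk hθ)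

theorem continuous_field {X : Type*} [TopologicalSpace X] {x : X → E} {θ : X → T}
    (hx : Continuous x) (hθ : Continuous θ) : Continuous fun p => f (x p) (θ p) :=
  (continuous_of_norm_sub_le h.field).comp (hx.prodMk hθ)

theorem norm_velocity_sub_le (y₁ y₂ : E) (θ₁ θ₂ : T) (w : U) :
    ‖(f₀ y₁ θ₁ + f y₁ θ₁ w) - (f₀ y₂ θ₂ + f y₂ θ₂ w)‖
      ≤ L * (1 + ‖w‖) * (‖y₁ - y₂‖ + dist θ₁ θ₂) := by
  rw [add_sub_add_comm, ← sub_apply]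
  calc _ ≤ L * (‖y₁ - y₂‖ + dist θ₁ θ₂) + L * (‖y₁ - y₂‖ + dist θ₁ θ₂) * ‖w‖ :=
        norm_add_le_of_le (h.drift _ _ _ _)
          (ContinuousLinearMap.le_of_opNorm_le _ (h.field _ _ _ _) w)
    _ = _ := by ring

theorem integrable_velocity {x : I → E} (hx : Continuous x) (θ : T)
    (u : Lp U 2 (volume : Measure I)) :
    Integrable fun s => f₀ (x s) θ + f (x s) θ (u s) :=
  (Continuous.integrable_of_compactSpace (h.continuous_drift hx continuous_const) _).add
    (integrable_clm_apply (h.continuous_field hx continuous_const) u)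

end

omit [NormedSpace ℝ U] in
theorem memLp_kernel (L : ℝ) (u : Lp U 2 (volume : Measure I)) :
    MemLp (fun s => L * (1 + ‖u s‖)) 2 := by
  have h1 : MemLp (fun _ : I => (1 : ℝ)) 2 := memLp_const 1
  have h2 : MemLp (fun s => 1 + ‖u s‖) 2 := h1.add (Lp.memLp u).norm
  exact h2.const_mul L

omit [NormedSpace ℝ U] in
theorem integral_kernel_sq_le (L : ℝ) {R : ℝ} {u : Lp U 2 (volume : Measure I)} (hu : ‖u‖ ≤ R) :
    ∫ s, (L * (1 + ‖u s‖)) ^ 2 ≤ 2 * L ^ 2 * (1 + R ^ 2) + 1 := by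
  have hsq : Integrable fun s => ‖u s‖ ^ 2 := (Lp.memLp u).norm.integrable_sq
  have hbd : Integrable fun s => 2 * L ^ 2 * (1 + ‖u s‖ ^ 2) :=
    ((integrable_const 1).add hsq).const_mul _
  calc _ ≤ ∫ s, 2 * L ^ 2 * (1 + ‖u s‖ ^ 2) := by
        refine integral_mono (memLp_kernel L u).integrable_sq hbd fun s => ?_
        have : 0 ≤ L ^ 2 * (1 - ‖u s‖) ^ 2 := by positivity
        simp only
        linarith
    _ = 2 * L ^ 2 * (1 + ‖u‖ ^ 2) := by
        rw [integral_const_mul, integral_add (integrable_const 1) hsq, Lp.integral_norm_sq_eq]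
        simp
    _ ≤ 2 * L ^ 2 * (1 + R ^ 2) + 1 := by
        have : 2 * L ^ 2 * (1 + ‖u‖ ^ 2) ≤ 2 * L ^ 2 * (1 + R ^ 2) := by gcongr
        linarith

variable (h : LipschitzFields L f₀ f)
include h

theorem existsUnique_trajectory [CompleteSpace E] (ξ : E) (θ : T)
    (u : Lp U 2 (volume : Measure I)) :
    ∃! x : C(I, E), ∀ t : I,
      x t = ξ + ∫ s in Set.Iic t, (f₀ (x s) θ + f (x s) θ (u s)) := by
  have hL := h.nonneg
  refine existsUnique_volterra (g := fun s y => f₀ y θ + f y θ (u s)) ξ (memLp_kernel L u)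
    (fun s => by positivity) (fun s y₁ y₂ => ?_) fun x => h.integrable_velocity x.continuous θ u
  simpa using h.norm_velocity_sub_le y₁ y₂ θ θ (u s)

/-- A trajectory is close to any curve which solves a perturbed integral equation. -/
theorem norm_sub_le_of_perturbed {R : ℝ} {u : Lp U 2 (volume : Measure I)} (hu : ‖u‖ ≤ R)
    {x y : I → E} (hx : Continuous x) (hy : Continuous y) {θ₁ θ₂ : T} {ξ : E} {r : I → E} {c : ℝ}
    (hxu : ∀ t, x t = ξ + ∫ s in Set.Iic t, (f₀ (x s) θ₁ + f (x s) θ₁ (u s)))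
    (hyu : ∀ t, y t = r t + ∫ s in Set.Iic t, (f₀ (y s) θ₂ + f (y s) θ₂ (u s)))
    (hr : ∀ t, ‖ξ - r t‖ ≤ c) (t : I) :
    ‖x t - y t‖ ≤ 2 * Real.exp (2 * (2 * L ^ 2 * (1 + R ^ 2) + 1)) *
      (c + L * (1 + R) * dist θ₁ θ₂) := by
  have hL := h.nonneg
  have hc : 0 ≤ c := (norm_nonneg _).trans (hr 0)
  have hR : 0 ≤ R := (norm_nonneg _).trans hu
  have hl := memLp_kernel L u
  have hl1 : Integrable fun s => L * (1 + ‖u s‖) := hl.integrable one_le_two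
  have hlL : ∫ s, L * (1 + ‖u s‖) ≤ L * (1 + R) := by
    rw [integral_const_mul, integral_add (integrable_const 1)
      ((Lp.memLp u).integrable one_le_two).norm]
    have := (Lp.integral_norm_le u).trans hu
    simp only [integral_const, probReal_univ, smul_eq_mul, mul_one]
    gcongr
  refine gronwall_of_memLp_two hl (fun s => by positivity) (by positivity)
    (integral_kernel_sq_le L hu) (φ := fun t => ‖x t - y t‖) (by fun_prop)
    (fun _ => norm_nonneg _) (by positivity) (fun t => ?_) t
  have hi₁ := h.integrable_velocity hx θ₁ u
  have hi₂ := h.integrable_velocity hy θ₂ u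
  have hj₁ : Integrable fun s => L * (1 + ‖u s‖) * ‖x s - y s‖ :=
    hl.integrable_mul_continuous (by fun_prop)
  have hj₂ : Integrable fun s => L * (1 + ‖u s‖) * dist θ₁ θ₂ := hl1.mul_const _
  have hd : ‖(∫ s in Set.Iic t, (f₀ (x s) θ₁ + f (x s) θ₁ (u s)))
      - ∫ s in Set.Iic t, (f₀ (y s) θ₂ + f (y s) θ₂ (u s))‖
      ≤ (∫ s in Set.Iic t, L * (1 + ‖u s‖) * ‖x s - y s‖) + L * (1 + R) * dist θ₁ θ₂ := by
    rw [← integral_sub hi₁.integrableOn hi₂.integrableOn]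
    refine (norm_integral_le_of_norm_le (hj₁.add hj₂).integrableOn
      (Eventually.of_forall fun s => (h.norm_velocity_sub_le _ _ _ _ _).trans_eq
        (mul_add _ _ _))).trans ?_
    simp only [Pi.add_apply]
    rw [integral_add hj₁.integrableOn hj₂.integrableOn, integral_mul_const]
    gcongr
    exact (setIntegral_le_integral hl1 (Eventually.of_forall fun s =>
      show 0 ≤ L * (1 + ‖u s‖) by positivity)).trans hlL
  calc ‖x t - y t‖ = ‖(ξ - r t) + ((∫ s in Set.Iic t, (f₀ (x s) θ₁ + f (x s) θ₁ (u s)))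
      - ∫ s in Set.Iic t, (f₀ (y s) θ₂ + f (y s) θ₂ (u s)))‖ := by
        rw [hxu t, hyu t, add_sub_add_comm]
    _ ≤ c + ((∫ s in Set.Iic t, L * (1 + ‖u s‖) * ‖x s - y s‖) + L * (1 + R) * dist θ₁ θ₂) :=
        norm_add_le_of_le (hr t) hd
    _ = _ := by ring

/-- The trajectories depend jointly continuously on time and parameter. -/
theorem exists_flow [CompleteSpace E] {x₀ : T → E} (hx₀ : Continuous x₀)
    (u : Lp U 2 (volume : Measure I)) :
    ∃ X : C(I × T, E), ∀ (t : I) (θ : T),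
      X (t, θ) = x₀ θ + ∫ s in Set.Iic t, (f₀ (X (s, θ)) θ + f (X (s, θ)) θ (u s)) := by
  choose x hx using fun θ => (h.existsUnique_trajectory (x₀ θ) θ u).exists
  have hcont : Continuous x := by
    refine continuous_iff_continuousAt.2 fun θ₀ => ?_
    rw [ContinuousAt, tendsto_iff_dist_tendsto_zero]
    have hc : Continuous fun θ => 2 * Real.exp (2 * (2 * L ^ 2 * (1 + ‖u‖ ^ 2) + 1)) *
        (‖x₀ θ - x₀ θ₀‖ + L * (1 + ‖u‖) * dist θ θ₀) := by fun_prop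
    refine squeeze_zero (fun _ => dist_nonneg) (fun θ => ?_) (by simpa using hc.tendsto θ₀)
    have hL := h.nonneg
    refine (ContinuousMap.dist_le (by positivity)).2 fun t => ?_
    rw [dist_eq_norm]
    exact h.norm_sub_le_of_perturbed le_rfl (x θ).continuous (x θ₀).continuous (hx θ) (hx θ₀)
      (fun _ => le_rfl) t
  refine ⟨⟨fun p => x p.2 p.1, ?_⟩, fun t θ => hx θ t⟩
  fun_prop

/-- Flows converge uniformly when the controls are bounded and converge weakly. -/
theorem tendsto_flow [CompactSpace T] [FiniteDimensional ℝ E] {x₀ : T → E}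
    {ι : Type*} {l : Filter ι} {u : ι → Lp U 2 (volume : Measure I)}
    {u₀ : Lp U 2 (volume : Measure I)} {R : ℝ} (hR : ∀ i, ‖u i‖ ≤ R)
    (hu : ∀ φ : Lp U 2 (volume : Measure I) →L[ℝ] ℝ, Tendsto (fun i => φ (u i)) l (𝓝 (φ u₀)))
    {X : ι → C(I × T, E)} {X₀ : C(I × T, E)}
    (hX : ∀ i t θ, X i (t, θ) = x₀ θ +
      ∫ s in Set.Iic t, (f₀ (X i (s, θ)) θ + f (X i (s, θ)) θ (u i s)))
    (hX₀ : ∀ t θ, X₀ (t, θ) = x₀ θ +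
      ∫ s in Set.Iic t, (f₀ (X₀ (s, θ)) θ + f (X₀ (s, θ)) θ (u₀ s))) :
    Tendsto X l (𝓝 X₀) := by
  have hL := h.nonneg
  let B : C(I × T, U →L[ℝ] E) :=
    ⟨fun q => f (X₀ q) q.2, h.continuous_field X₀.continuous continuous_snd⟩
  have hB := tendstoUniformly_primitive B hR hu
  rw [ContinuousMap.tendsto_iff_tendstoUniformly, Metric.tendstoUniformly_iff]
  rw [Metric.tendstoUniformly_iff] at hB
  intro ε hε
  set C := 2 * Real.exp (2 * (2 * L ^ 2 * (1 + R ^ 2) + 1))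
  have hC : 0 < C := by positivity
  filter_upwards [hB (ε / (2 * C)) (by positivity)] with i hi
  rintro ⟨t, θ⟩
  have hs := h.norm_sub_le_of_perturbed (hR i) (x := fun t => X i (t, θ))
    (y := fun t => X₀ (t, θ)) (θ₁ := θ) (θ₂ := θ) (ξ := x₀ θ)
    (r := fun t => x₀ θ +
      ((∫ s in Set.Iic t, B (s, θ) (u₀ s)) - ∫ s in Set.Iic t, B (s, θ) (u i s)))
    (c := ε / (2 * C)) (by fun_prop) (by fun_prop) (fun t => hX i t θ) (fun t => ?_) (fun t => ?_) t
  · rw [dist_comm, dist_eq_norm]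
    refine hs.trans_lt ?_
    rw [dist_self, mul_zero, add_zero]
    change C * (ε / (2 * C)) < ε
    have : C * (ε / (2 * C)) = ε / 2 := by field_simp
    linarith
  · have hX₀θ : Continuous fun s => X₀ (s, θ) := by fun_prop
    have h₀ := Continuous.integrable_of_compactSpace
      (h.continuous_drift hX₀θ (continuous_const (y := θ))) (volume : Measure I)
    have h₁ := fun v => integrable_clm_apply (h.continuous_field hX₀θ (continuous_const (y := θ))) v
    have hBf : ∀ s, B (s, θ) = f (X₀ (s, θ)) θ := fun s => rfl
    simp only [hBf]
    rw [hX₀ t θ, integral_add h₀.integrableOn (h₁ u₀).integrableOn,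
      integral_add h₀.integrableOn (h₁ (u i)).integrableOn]
    abel
  · rw [sub_add_cancel_left, norm_neg, ← dist_eq_norm]
    exact (hi (t, θ)).le

end LipschitzFields

end Flow

section Average

variable {T : Type*} [TopologicalSpace T] [CompactSpace T] [FirstCountableTopology T]
  [MeasurableSpace T] [OpensMeasurableSpace T]

omit [MeasurableSpace T] [OpensMeasurableSpace T] in
theorem continuous_integral_fst (ν : Measure I) [IsFiniteMeasure ν] (h : C(I × T, ℝ)) :
    Continuous fun θ => ∫ t, h (t, θ) ∂ν := by
  refine continuous_of_dominated (bound := fun _ => ‖h‖)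
    (fun θ => Continuous.aestronglyMeasurable (by fun_prop))
    (fun θ => Eventually.of_forall fun t => h.norm_coe_le_norm _) (integrable_const _)
    (Eventually.of_forall fun t => by fun_prop)

theorem integral_integral_sub_le (ν : Measure I) [IsProbabilityMeasure ν] (P : Measure T)
    [IsProbabilityMeasure P] (h h' : C(I × T, ℝ)) :
    ‖(∫ θ, ∫ t, h (t, θ) ∂ν ∂P) - ∫ θ, ∫ t, h' (t, θ) ∂ν ∂P‖ ≤ ‖h - h'‖ := by
  have hi : ∀ h : C(I × T, ℝ), Integrable (fun θ => ∫ t, h (t, θ) ∂ν) P := fun h =>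
    (continuous_integral_fst ν h).integrable_of_compactSpace P
  have hi' : ∀ (h : C(I × T, ℝ)) (θ : T), Integrable (fun t => h (t, θ)) ν := fun h θ =>
    Continuous.integrable_of_compactSpace (by fun_prop) ν
  rw [← integral_sub (hi h) (hi h')]
  have hb : ∀ θ, ‖(∫ t, h (t, θ) ∂ν) - ∫ t, h' (t, θ) ∂ν‖ ≤ ‖h - h'‖ := by
    intro θ
    rw [← integral_sub (hi' h θ) (hi' h' θ)]
    simpa using norm_integral_le_of_norm_le_const (μ := ν)
      (Eventually.of_forall fun t => (h - h').norm_coe_le_norm (t, θ))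
  simpa using norm_integral_le_of_norm_le_const (μ := P) (Eventually.of_forall hb)

theorem tendsto_integral_integral {ι : Type*} {l : Filter ι} (ν : Measure I)
    [IsProbabilityMeasure ν] {P : ι → ProbabilityMeasure T} {P₀ : ProbabilityMeasure T}
    (hP : Tendsto P l (𝓝 P₀)) {h : ι → C(I × T, ℝ)} {h₀ : C(I × T, ℝ)}
    (hh : Tendsto h l (𝓝 h₀)) :
    Tendsto (fun i => ∫ θ, ∫ t, h i (t, θ) ∂ν ∂(P i : Measure T)) l
      (𝓝 (∫ θ, ∫ t, h₀ (t, θ) ∂ν ∂(P₀ : Measure T))) := by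
  have h1 : Tendsto (fun i => ∫ θ, ∫ t, h₀ (t, θ) ∂ν ∂(P i : Measure T)) l
      (𝓝 (∫ θ, ∫ t, h₀ (t, θ) ∂ν ∂(P₀ : Measure T))) :=
    ProbabilityMeasure.tendsto_iff_forall_integral_tendsto.1 hP
      (BoundedContinuousFunction.mkOfCompact ⟨_, continuous_integral_fst ν h₀⟩)
  have h2 : Tendsto (fun i => (∫ θ, ∫ t, h i (t, θ) ∂ν ∂(P i : Measure T))
      - ∫ θ, ∫ t, h₀ (t, θ) ∂ν ∂(P i : Measure T)) l (𝓝 0) :=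
    squeeze_zero_norm (fun i => integral_integral_sub_le ν _ (h i) h₀)
      (tendsto_iff_norm_sub_tendsto_zero.1 hh)
  simpa using h2.add h1

end Average

section Ensemble

/-- A matrix as a continuous linear map between Euclidean spaces. -/
noncomputable def matrixCLM {n k : ℕ} (M : Matrix (Fin n) (Fin k) ℝ) : Euc k →L[ℝ] Euc n :=
  ∑ i, (EuclideanSpace.proj i : Euc k →L[ℝ] ℝ).smulRight (column M i)

theorem matrixCLM_apply {n k : ℕ} (M : Matrix (Fin n) (Fin k) ℝ) (w : Euc k) :
    matrixCLM M w = WithLp.toLp 2 (M.mulVec w) := by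
  ext r
  simp [matrixCLM, column, Matrix.mulVec, dotProduct, mul_comm]

theorem norm_matrixCLM_sub_le {n k : ℕ} (M M' : Matrix (Fin n) (Fin k) ℝ) :
    ‖matrixCLM M - matrixCLM M'‖ ≤ ∑ i, ‖column M i - column M' i‖ := by
  rw [matrixCLM, matrixCLM, ← Finset.sum_sub_distrib]
  refine (norm_sum_le _ _).trans (Finset.sum_le_sum fun i _ => ?_)
  refine ContinuousLinearMap.opNorm_le_bound _ (norm_nonneg _) fun w => ?_
  change ‖w i • column M i - w i • column M' i‖ ≤ _
  rw [← smul_sub, norm_smul, mul_comm]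
  gcongr
  exact PiLp.norm_apply_le w i

variable {n k : ℕ} {T : Type*} [PseudoMetricSpace T] {F₀ : Euc n → T → Euc n}
  {F : Euc n → T → Matrix (Fin n) (Fin k) ℝ} {L : ℝ}

theorem lipschitzFields_matrixCLM (hL : 0 ≤ L)
    (hF₀ : ∀ x₁ x₂ θ₁ θ₂, ‖F₀ x₁ θ₁ - F₀ x₂ θ₂‖ ≤ L * (‖x₁ - x₂‖ + dist θ₁ θ₂))
    (hF : ∀ x₁ x₂ θ₁ θ₂ i,
      ‖column (F x₁ θ₁) i - column (F x₂ θ₂) i‖ ≤ L * (‖x₁ - x₂‖ + dist θ₁ θ₂)) :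
    LipschitzFields ((k + 1) * L) F₀ (fun y θ => matrixCLM (F y θ)) where
  nonneg := by positivity
  drift x₁ x₂ θ₁ θ₂ := by
    have : 0 ≤ k * L * (‖x₁ - x₂‖ + dist θ₁ θ₂) := by positivity
    linarith [hF₀ x₁ x₂ θ₁ θ₂]
  field x₁ x₂ θ₁ θ₂ := by
    have h1 : 0 ≤ L * (‖x₁ - x₂‖ + dist θ₁ θ₂) := by positivity
    have h2 := (norm_matrixCLM_sub_le (F x₁ θ₁) (F x₂ θ₂)).trans
      (Finset.sum_le_sum fun i _ => hF x₁ x₂ θ₁ θ₂ i)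
    simp only [Finset.sum_const, Finset.card_univ, Fintype.card_fin, nsmul_eq_mul] at h2
    linarith

variable (hlip : LipschitzFields L F₀ (fun y θ => matrixCLM (F y θ))) {x₀ : T → Euc n}

omit [PseudoMetricSpace T] in
theorem isTrajectory_iff {u : Control k} {θ : T} {x : C(I, Euc n)} :
    IsTrajectory F₀ F x₀ u θ x ↔ ∀ t : I, x t = x₀ θ +
      ∫ s in Set.Iic t, (F₀ (x s) θ + matrixCLM (F (x s) θ) (u s)) := by
  simp only [IsTrajectory, velocity, matrixCLM_apply]

include hlip

theorem existsUnique_isTrajectory (u : Control k) (θ : T) :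
    ∃! x : C(I, Euc n), IsTrajectory F₀ F x₀ u θ x := by
  simp_rw [isTrajectory_iff]
  exact hlip.existsUnique_trajectory (x₀ θ) θ u

theorem exists_trajectoryFlow (hx₀ : Continuous x₀) (u : Control k) :
    ∃ X : C(I × T, Euc n), (∀ t θ, trajectory F₀ F x₀ u θ t = X (t, θ)) ∧
      ∀ t θ, X (t, θ) = x₀ θ +
        ∫ s in Set.Iic t, (F₀ (X (s, θ)) θ + matrixCLM (F (X (s, θ)) θ) (u s)) := by
  obtain ⟨X, hX⟩ := hlip.exists_flow hx₀ u
  refine ⟨X, fun t θ => ?_, hX⟩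
  have hu := existsUnique_isTrajectory (x₀ := x₀) hlip u θ
  have h1 : IsTrajectory F₀ F x₀ u θ (trajectory F₀ F x₀ u θ) := Classical.epsilon_spec hu.exists
  have h2 : IsTrajectory F₀ F x₀ u θ ⟨fun t => X (t, θ), by fun_prop⟩ :=
    isTrajectory_iff.2 fun t => hX t θ
  rw [hu.unique h1 h2]
  rfl

theorem integrable_cost_trajectory [CompactSpace T] [SecondCountableTopology T]
    [MeasurableSpace T] [OpensMeasurableSpace T] (hx₀ : Continuous x₀) {a : I × Euc n × T → ℝ}
    (ha : Continuous a) (u : Control k) (μ : Measure (I × T)) [IsFiniteMeasure μ] :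
    Integrable (fun p : I × T => a (p.1, trajectory F₀ F x₀ u p.2 p.1, p.2)) μ := by
  obtain ⟨X, hXt, -⟩ := exists_trajectoryFlow hlip hx₀ u
  simp only [hXt]
  exact Continuous.integrable_of_compactSpace (by fun_prop) μ

/-- The averaged end cost is continuous under narrow convergence of the parameter measures and
bounded weak convergence of the controls. -/
theorem tendsto_averageCost [CompactSpace T] [MeasurableSpace T] [OpensMeasurableSpace T]
    (hx₀ : Continuous x₀) {a : I × Euc n × T → ℝ} (ha : Continuous a) (ν : Measure I)
    [IsProbabilityMeasure ν] {ι : Type*} {l : Filter ι} {P : ι → ProbabilityMeasure T}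
    {P₀ : ProbabilityMeasure T} (hP : Tendsto P l (𝓝 P₀)) {u : ι → Control k} {u₀ : Control k}
    {R : ℝ} (hR : ∀ i, ‖u i‖ ≤ R)
    (hu : ∀ φ : Control k →L[ℝ] ℝ, Tendsto (fun i => φ (u i)) l (𝓝 (φ u₀))) :
    Tendsto (fun i => ∫ θ, ∫ t, a (t, trajectory F₀ F x₀ (u i) θ t, θ) ∂ν ∂(P i : Measure T)) l
      (𝓝 (∫ θ, ∫ t, a (t, trajectory F₀ F x₀ u₀ θ t, θ) ∂ν ∂(P₀ : Measure T))) := by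
  choose X hXt hX using exists_trajectoryFlow hlip hx₀
  simp only [hXt]
  let A : C(I × T, Euc n) → C(I × T, ℝ) := fun Y => ⟨fun p => a (p.1, Y p, p.2), by fun_prop⟩
  have hA : Continuous A := ContinuousMap.continuous_of_continuous_uncurry _ (by
    simp only [Function.uncurry_def, A, ContinuousMap.coe_mk]; fun_prop)
  exact tendsto_integral_integral ν hP (h := fun i => A (X (u i))) (h₀ := A (X u₀))
    ((hA.tendsto _).comp (hlip.tendsto_flow hR hu (fun i => hX (u i)) (hX u₀)))

omit hlip [PseudoMetricSpace T] in
theorem norm_le_of_isMinimizer [MeasurableSpace T] {a : I × Euc n × T → ℝ}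
    (ha : ∀ p, 0 ≤ a p) {β : ℝ} (hβ : 0 < β) (ν : Measure I) (μ : Measure T) {u : Control k}
    (hu : ∀ v, ensembleCost F₀ F x₀ a ν β μ u ≤ ensembleCost F₀ F x₀ a ν β μ v) :
    ‖u‖ ≤ Real.sqrt (2 / β * ensembleCost F₀ F x₀ a ν β μ 0) := by
  refine Real.le_sqrt_of_sq_le ?_
  have h1 : β / 2 * ‖u‖ ^ 2 ≤ ensembleCost F₀ F x₀ a ν β μ 0 :=
    (le_add_of_nonneg_left (integral_nonneg fun θ => integral_nonneg fun t => ha _)).trans (hu 0)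
  calc ‖u‖ ^ 2 = 2 / β * (β / 2 * ‖u‖ ^ 2) := by field_simp
    _ ≤ _ := by gcongr

theorem gammaConverges_ensembleCost [CompactSpace T] [MeasurableSpace T] [OpensMeasurableSpace T]
    (hx₀ : Continuous x₀) {a : I × Euc n × T → ℝ} (ha : Continuous a) {β : ℝ} (hβ : 0 ≤ β)
    (ν : Measure I) [IsProbabilityMeasure ν] {P : ℕ → ProbabilityMeasure T}
    {P₀ : ProbabilityMeasure T} (hP : Tendsto P atTop (𝓝 P₀)) (ρ : ℝ) :
    GammaConverges (fun N => restrictToBall (ensembleCost F₀ F x₀ a ν β (P N)) ρ)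
      (restrictToBall (ensembleCost F₀ F x₀ a ν β P₀) ρ) := by
  refine ⟨fun u v hv => ?_, fun u => ⟨fun _ => u, tendsto_const_nhds, ?_⟩⟩
  · set w : ℕ → Control k := fun N => (toWeakSpace ℝ (Control k)).symm (v N)
    set w₀ : Control k := (toWeakSpace ℝ (Control k)).symm u
    have hw : ∀ φ : Control k →L[ℝ] ℝ, Tendsto (fun N => φ (w N)) atTop (𝓝 (φ w₀)) := fun φ =>
      ((WeakBilin.eval_continuous (topDualPairing ℝ (Control k)).flip φ).tendsto _).comp
        ((continuous_subtype_val.tendsto u).comp hv)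
    have hlow : Tendsto (fun N =>
        (∫ θ, ∫ t, a (t, trajectory F₀ F x₀ (w N) θ t, θ) ∂ν ∂(P N : Measure T))
          + β / 2 * (2 * inner ℝ w₀ (w N) - ‖w₀‖ ^ 2)) atTop
        (𝓝 (ensembleCost F₀ F x₀ a ν β P₀ w₀)) := by
      have h1 := tendsto_averageCost hlip hx₀ ha ν hP (fun N => (v N).2) hw
      have h2 := (((hw (innerSL ℝ w₀)).const_mul 2).sub_const (‖w₀‖ ^ 2)).const_mul (β / 2)
      simp only [innerSL_apply_apply, real_inner_self_eq_norm_sq] at h2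
      convert h1.add h2 using 2
      rw [ensembleCost]; ring
    change ((ensembleCost F₀ F x₀ a ν β P₀ w₀ : ℝ) : EReal) ≤
      liminf (fun N => ((ensembleCost F₀ F x₀ a ν β (P N) (w N) : ℝ) : EReal)) atTop
    rw [← (EReal.tendsto_coe.2 hlow).liminf_eq]
    refine liminf_le_liminf (Eventually.of_forall fun N => EReal.coe_le_coe_iff.2 ?_)
    rw [ensembleCost]
    gcongr
    have := norm_sub_sq_real w₀ (w N)
    have := sq_nonneg ‖w₀ - w N‖
    linarith
  · have h1 := tendsto_averageCost hlip hx₀ ha ν hP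
      (u := fun _ => (toWeakSpace ℝ (Control k)).symm u)
      (fun N => u.2) (fun φ => tendsto_const_nhds)
    have h2 := h1.add_const (β / 2 * ‖(toWeakSpace ℝ (Control k)).symm u‖ ^ 2)
    exact (EReal.tendsto_coe.2 h2).limsup_eq.le

end Ensemble

theorem mainTheorem2 {m n k : ℕ}
    (Θ : Set (Euc m)) (hΘ : IsCompact Θ)
    (F₀ : Euc n → Θ → Euc n) (F : Euc n → Θ → Matrix (Fin n) (Fin k) ℝ)
    (L : ℝ) (hL : 0 < L)
    (hF₀ : ∀ (x₁ x₂ : Euc n) (θ₁ θ₂ : Θ),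
      ‖F₀ x₁ θ₁ - F₀ x₂ θ₂‖ ≤ L * (‖x₁ - x₂‖ + ‖(θ₁ : Euc m) - θ₂‖))
    (hF : ∀ (x₁ x₂ : Euc n) (θ₁ θ₂ : Θ) (i : Fin k),
      ‖column (F x₁ θ₁) i - column (F x₂ θ₂) i‖ ≤ L * (‖x₁ - x₂‖ + ‖(θ₁ : Euc m) - θ₂‖))
    (x₀ : Θ → Euc n) (hx₀ : Continuous x₀)
    (a : I × Euc n × Θ → ℝ) (ha : Continuous a) (ha_nonneg : ∀ p, 0 ≤ a p)
    (β : ℝ) (hβ : 0 < β)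
    (ν : Measure I) [IsProbabilityMeasure ν]
    (μ : ProbabilityMeasure Θ) (μN : ℕ → ProbabilityMeasure Θ)
    (hμN : ∀ N, 1 ≤ N → IsDiscreteWith N (μN N : Measure Θ))
    (hconv : Tendsto μN atTop (𝓝 μ)) :
    -- the trajectories and the integrals in the functionals are well defined
    (∀ (u : Control k) (θ : Θ), ∃! x : C(I, Euc n), IsTrajectory F₀ F x₀ u θ x) ∧
    (∀ (u : Control k) (P : ProbabilityMeasure Θ),
      Integrable (fun p : I × Θ => a (p.1, trajectory F₀ F x₀ u p.2 p.1, p.2))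
        (ν.prod (P : Measure Θ))) ∧
    -- some ball contains all the minimizers of the ensemble functional
    (∃ ρ : ℝ, 0 < ρ ∧ ∀ u : Control k,
      (∀ v : Control k, ensembleCost F₀ F x₀ a ν β μ u ≤ ensembleCost F₀ F x₀ a ν β μ v) →
        ‖u‖ ≤ ρ) ∧
    -- `Γ`-convergence on every ball, with respect to the weak topology of `L²`
    (∀ ρ : ℝ, 0 < ρ →
      GammaConverges
        (fun N => restrictToBall (ensembleCost F₀ F x₀ a ν β (μN N)) ρ)
        (restrictToBall (ensembleCost F₀ F x₀ a ν β μ) ρ)) := by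
  have : CompactSpace Θ := isCompact_iff_compactSpace.1 hΘ
  have hlip := lipschitzFields_matrixCLM (F₀ := F₀) (F := F) hL.le
    (by simpa only [Subtype.dist_eq, dist_eq_norm] using hF₀)
    (by simpa only [Subtype.dist_eq, dist_eq_norm] using hF)
  refine ⟨fun u θ => existsUnique_isTrajectory hlip u θ,
    fun u P => integrable_cost_trajectory hlip hx₀ ha u _,
    ⟨_, add_pos_of_nonneg_of_pos (Real.sqrt_nonneg _) one_pos, fun u hu =>
      (norm_le_of_isMinimizer ha_nonneg hβ ν _ hu).trans (le_add_of_nonneg_right zero_le_one)⟩,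
    fun ρ _ => gammaConverges_ensembleCost hlip hx₀ ha hβ.le ν hconv ρ⟩
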